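/- Let $S$ be a compact connected oriented smooth surface, possibly with boundary, and let $A$ be a primitive $N$-th root of unity with $N$ odd. Let $\mathcal S^A(S)$ be the Kauffman skein algebra: the complex vector space spanned by framed links in the thickened surface $S\times[0,1]$, modulo isotopy and the skein relation $[K_1]=A^{-1}[K_0]+A[K_\infty]$, with product given by superposition. Let $T_N$ be the normalized Chebyshev polynomial defined by $T_0=2$, $T_1=x$, $T_{n+1}=xT_n-T_{n-1}$. Let $\rho\colon\mathcal S^A(S)\to\mathrm{End}(V)$ be an irreducible representation on a finite-dimensional complex vector space $V$. Let $\kappa_\rho\colon\mathcal S^{1}(S)\to\mathbb C$ denote the algebra homomorphism such that $\rho(T_N([K]))=\kappa_\rho([K])\,\mathrm{Id}_V$ for every simple closed curve $K$ in $S$, endowed with the vertical framing. A spinned homomorphism $r$ is a class $[\hat r,\sigma]$ in $(\mathcal R_{\mathrm{SL}_2(\mathbb C)}(S)\times\mathrm{Spin}(S))/H^1(S;\mathbb Z_2)$, where $\hat r\colon\pi_1(S)\to\mathrm{SL}_2(\mathbb C)$ is considered up to equality of traces and $\sigma$ is a spin structure; for a framed knot $K$, set $\mathrm{Tr}\,r(K)=(-1)^{\sigma(K)}\,\mathrm{Tr}\,\hat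 r(K)$, where $\sigma(K)\in\mathbb Z_2$ is the monodromy of the framing of $K$ with respect to $\sigma$, normalized to be $0$ for the boundary of a disk in $S$ with vertical framing. Suppose that $r_\rho$ is the classical shadow of $\rho$: namely, $\kappa_\rho$ exists, it is nonzero on the skein of some non-empty link, and $\kappa_\rho([K])=-\mathrm{Tr}\,r_\rho(K)$ for every framed knot $K$. Let $P_i$ be a simple closed curve in $S$ parallel to the $i$-th boundary component, with vertical framing. Then there is a unique number $p_i\in\mathbb C$, the $i$-th puncture invariant of $\rho$, such that $\rho([P_i])=p_i\,\mathrm{Id}_V$, and $$T_N(p_i)=\kappa_\rho([P_i])=-\mathrm{Tr}\,r_\rho(P_i).$$ In particular, $p_i$ belongs to the set $\{z\in\mathbb C : T_N(z)=-\mathrm{Tr}\,r_\rho(P_i)\}$, which is finite and is determined by the classical shadow. -/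

import Mathlib

open Set Topology
open scoped Manifold ContDiff MatrixGroups

noncomputable section

set_option linter.unusedSectionVars false

namespace KauffmanSkein

/-- The model plane `ℝ²`. -/
abbrev Plane : Type := EuclideanSpace ℝ (Fin 2)

section Surface

variable (S : Type*) [TopologicalSpace S] [ChartedSpace (EuclideanHalfSpace 2) S]
  [IsManifold (𝓡∂ 2) ∞ S]

/-- An orientation of a smooth surface `S` (possibly with boundary). The tangent plane at `x` is
identified with `ℝ²` by the preferred chart at `x`; `sign x = 1` when this identification preserves
orientations, and `sign x = -1` when it reverses them. Coherence says that, for `y` close to `x`,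
the orientation at `y` read in the preferred chart at `x` agrees with the orientation at `x`. -/
structure SurfaceOrientation where
  sign : S → ℤˣ
  coherent : ∀ x : S, ∀ᶠ y in 𝓝 x,
    0 < (((sign x * sign y : ℤˣ) : ℤ) : ℝ) * (tangentCoordChange (𝓡∂ 2) y x y).det

/-- The tangent bundle of `S × ℝ`, as pairs `((x, u), (h, w))`: the point is `(x, h) ∈ S × ℝ`, and
the tangent vector at this point is `(u, w) ∈ T_x S ⊕ ℝ`. -/
abbrev FramedPoint : Type _ := TangentBundle (𝓡∂ 2) S × (ℝ × ℝ)

variable {S}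

/-- The point of `S` below a framed point. -/
def FramedPoint.base (q : FramedPoint S) : S := q.1.proj

/-- The height of a framed point. -/
def FramedPoint.height (q : FramedPoint S) : ℝ := q.2.1

/-- The component of the framing vector that is tangent to `S`. -/
def FramedPoint.horizontal (q : FramedPoint S) : TangentSpace (𝓡∂ 2) q.base := q.1.2

/-- The component of the framing vector in the direction of `ℝ`. -/
def FramedPoint.vertical (q : FramedPoint S) : ℝ := q.2.2

/-- The point of `S × ℝ` where a framed point sits. -/
def FramedPoint.pos (q : FramedPoint S) : S × ℝ := (q.base, q.height)

/-- The framing vector is parallel to the `ℝ` factor, and points upwards. -/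
def FramedPoint.IsVertical (q : FramedPoint S) : Prop := q.horizontal = 0 ∧ 0 < q.vertical

/-- `γ : ℝ → T(S × ℝ)` is a smooth `1`-periodic parametrization of a framed knot in the interior
of `S × [0,1]`: it induces a smooth embedding of the circle `ℝ/ℤ`, together with a smooth vector
field along it that is never tangent to it. -/
structure IsFramedKnotParam (γ : ℝ → FramedPoint S) : Prop where
  smooth_horizontal : ContMDiff 𝓘(ℝ, ℝ) (𝓡∂ 2).tangent ∞ (fun t => (γ t).1)
  smooth_vertical : ContDiff ℝ ∞ (fun t => (γ t).2)
  periodic : ∀ t, γ (t + 1) = γ t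
  interior : ∀ t, (γ t).base ∈ (𝓡∂ 2).interior S ∧ (γ t).height ∈ Ioo (0 : ℝ) 1
  embedded : ∀ s t, (γ s).pos = (γ t).pos → ∃ n : ℤ, s - t = n
  framed : ∀ t, LinearIndependent ℝ
    ![((mfderiv 𝓘(ℝ, ℝ) (𝓡∂ 2) (fun τ => (γ τ).base) t (1 : ℝ) : Plane),
        deriv (fun τ => (γ τ).height) t),
      (((γ t).horizontal : Plane), (γ t).vertical)]

/-- A parametrization of a framed link: finitely many disjoint framed knots. -/
structure IsFramedLinkParam {ι : Type} (γ : ι → ℝ → FramedPoint S) : Prop where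
  knot : ∀ i, IsFramedKnotParam (γ i)
  disjoint : ∀ i j s t, (γ i s).pos = (γ j t).pos → i = j

/-- The framed set that is covered by a parametrization. -/
def paramCarrier {ι : Type} (γ : ι → ℝ → FramedPoint S) : Set (FramedPoint S) :=
  {q | ∃ i t, γ i t = q}

variable (S) in
/-- A framed link in (the interior of) `S × [0,1]`, possibly empty: an unoriented and
unparametrized compact smooth `1`-submanifold, together with its framing. -/
@[ext] structure FramedLink where
  carrier : Set (FramedPoint S)
  exists_param : ∃ (ι : Type) (_ : Finite ι) (γ : ι → ℝ → FramedPoint S),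
    IsFramedLinkParam γ ∧ carrier = paramCarrier γ

/-- Smooth isotopy of framed links in `S × [0,1]`. -/
def Isotopic (K L : FramedLink S) : Prop :=
  ∃ (ι : Type) (_ : Finite ι) (Γ : ℝ → ι → ℝ → FramedPoint S),
    (∀ i, ContMDiffOn 𝓘(ℝ, ℝ × ℝ) (𝓡∂ 2).tangent ∞
      (fun p : ℝ × ℝ => (Γ p.1 i p.2).1) (Icc (0 : ℝ) 1 ×ˢ univ)) ∧
    (∀ i, ContDiffOn ℝ ∞ (fun p : ℝ × ℝ => (Γ p.1 i p.2).2) (Icc (0 : ℝ) 1 ×ˢ univ)) ∧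
    (∀ s ∈ Icc (0 : ℝ) 1, IsFramedLinkParam (Γ s)) ∧
    K.carrier = paramCarrier (Γ 0) ∧ L.carrier = paramCarrier (Γ 1)

/-! ### Superposition -/

/-- The effect on framed points of the affine rescaling `h ↦ a h + b` of heights. -/
def FramedPoint.rescale (a b : ℝ) (q : FramedPoint S) : FramedPoint S :=
  (q.1, (a * q.2.1 + b, a * q.2.2))

theorem IsFramedKnotParam.rescale {γ : ℝ → FramedPoint S} (hγ : IsFramedKnotParam γ) {a b : ℝ}
    (ha : 0 < a) (hb : 0 ≤ b) (hab : a + b ≤ 1) :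
    IsFramedKnotParam (fun t => (γ t).rescale a b) where
  smooth_horizontal := hγ.smooth_horizontal
  smooth_vertical := by
    have h := hγ.smooth_vertical
    have h1 : ContDiff ℝ ∞ (fun t => (γ t).2.1) := contDiff_fst.comp h
    have h2 : ContDiff ℝ ∞ (fun t => (γ t).2.2) := contDiff_snd.comp h
    exact ((contDiff_const.mul h1).add contDiff_const).prodMk (contDiff_const.mul h2)
  periodic t := by simp [FramedPoint.rescale, hγ.periodic t]
  interior t := by
    refine ⟨(hγ.interior t).1, ?_⟩
    obtain ⟨h0, h1⟩ := (hγ.interior t).2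
    simp only [FramedPoint.height] at h0 h1
    constructor
    · simp only [FramedPoint.height, FramedPoint.rescale]; positivity
    · simp only [FramedPoint.height, FramedPoint.rescale]; nlinarith
  embedded s t h := by
    apply hγ.embedded
    simp only [FramedPoint.pos, FramedPoint.base, FramedPoint.height, FramedPoint.rescale,
      Prod.mk.injEq] at h ⊢
    refine ⟨h.1, ?_⟩
    have := h.2
    have h3 : a * (γ s).2.1 = a * (γ t).2.1 := by linarith
    exact mul_left_cancel₀ ha.ne' h3
  framed t := by
    have h := hγ.framed t
    have hd : deriv (fun τ => ((γ τ).rescale a b).height) t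
        = a * deriv (fun τ => (γ τ).height) t := by
      have : (fun τ => ((γ τ).rescale a b).height) = fun τ => a * (γ τ).height + b := rfl
      rw [this, deriv_add_const, deriv_const_mul_field]
    rw [LinearIndependent.pair_iff] at h ⊢
    intro c d hcd
    apply h c d
    rw [hd] at hcd
    have e1 := congrArg Prod.fst hcd
    have e2 := congrArg Prod.snd hcd
    refine Prod.ext e1 ?_
    have e3 : c * (a * deriv (fun τ => (γ τ).height) t) + d * (a * (γ t).2.2) = 0 := e2
    have : a * (c * deriv (fun τ => (γ τ).height) t + d * (γ t).2.2) = 0 := by linarith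
    exact (mul_eq_zero.mp this).resolve_left ha.ne'

/-- Stacking parametrized links above each other, after affine rescalings of the heights. -/
theorem IsFramedLinkParam.stack {ι κ : Type} {γ : ι → ℝ → FramedPoint S}
    {δ : κ → ℝ → FramedPoint S} (hγ : IsFramedLinkParam γ) (hδ : IsFramedLinkParam δ)
    (hlt : ∀ i j s t, (γ i s).height < (δ j t).height) :
    IsFramedLinkParam (Sum.elim γ δ) where
  knot i := by
    rcases i with i | i
    · exact hγ.knot i
    · exact hδ.knot i
  disjoint i j s t h := by
    rcases i with i | i <;> rcases j with j | j
    · exact congrArg _ (hγ.disjoint i j s t h)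
    · exact absurd (congrArg Prod.snd h) (hlt i j s t).ne
    · exact absurd (congrArg Prod.snd h) (hlt j i t s).ne'
    · exact congrArg _ (hδ.disjoint i j s t h)

theorem IsFramedLinkParam.rescale {ι : Type} {γ : ι → ℝ → FramedPoint S}
    (hγ : IsFramedLinkParam γ) {a b : ℝ} (ha : 0 < a) (hb : 0 ≤ b) (hab : a + b ≤ 1) :
    IsFramedLinkParam (fun i t => (γ i t).rescale a b) where
  knot i := (hγ.knot i).rescale ha hb hab
  disjoint i j s t h := by
    apply hγ.disjoint i j s t
    simp only [FramedPoint.pos, FramedPoint.base, FramedPoint.height, FramedPoint.rescale,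
      Prod.mk.injEq] at h ⊢
    refine ⟨h.1, ?_⟩
    have h3 : a * (γ i s).2.1 = a * (γ j t).2.1 := by linarith [h.2]
    exact mul_left_cancel₀ ha.ne' h3

theorem IsFramedLinkParam.rescale_height {ι : Type} {γ : ι → ℝ → FramedPoint S}
    (hγ : IsFramedLinkParam γ) {a : ℝ} (ha : 0 < a) (b : ℝ) (i : ι) (t : ℝ) :
    b < ((γ i t).rescale a b).height ∧ ((γ i t).rescale a b).height < a + b := by
  obtain ⟨h0, h1⟩ := ((hγ.knot i).interior t).2
  simp only [FramedPoint.height, FramedPoint.rescale] at *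
  constructor <;> nlinarith

theorem paramCarrier_elim {ι κ : Type} (γ : ι → ℝ → FramedPoint S) (δ : κ → ℝ → FramedPoint S) :
    paramCarrier (Sum.elim γ δ) = paramCarrier γ ∪ paramCarrier δ := by
  ext q; simp [paramCarrier]

theorem paramCarrier_rescale {ι : Type} (γ : ι → ℝ → FramedPoint S) (a b : ℝ) :
    paramCarrier (fun i t => (γ i t).rescale a b)
      = FramedPoint.rescale a b '' paramCarrier γ := by
  ext q; simp [paramCarrier]

/-- The superposition `K · L`: rescale `K` into `S × [0,1/2]` and `L` into `S × [1/2,1]`, and take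
the union. -/
def FramedLink.superpose (K L : FramedLink S) : FramedLink S where
  carrier := FramedPoint.rescale (1 / 2) 0 '' K.carrier ∪
    FramedPoint.rescale (1 / 2) (1 / 2) '' L.carrier
  exists_param := by
    obtain ⟨ι, _, γ, hγ, hK⟩ := K.exists_param
    obtain ⟨κ, _, δ, hδ, hL⟩ := L.exists_param
    refine ⟨ι ⊕ κ, inferInstance, Sum.elim (fun i t => (γ i t).rescale (1 / 2) 0)
      (fun i t => (δ i t).rescale (1 / 2) (1 / 2)), ?_, ?_⟩
    · refine (hγ.rescale (by norm_num) (by norm_num) (by norm_num)).stack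
        (hδ.rescale (by norm_num) (by norm_num) (by norm_num)) fun i j s t => ?_
      have h1 := (hγ.rescale_height (a := 1 / 2) (by norm_num) 0 i s).2
      have h2 := (hδ.rescale_height (a := 1 / 2) (by norm_num) (1 / 2) j t).1
      linarith
    · rw [paramCarrier_elim, paramCarrier_rescale, paramCarrier_rescale, hK, hL]

variable (S) in
/-- The empty link. -/
def FramedLink.empty : FramedLink S where
  carrier := ∅
  exists_param := ⟨Empty, inferInstance, fun i => i.elim,
    ⟨fun i => i.elim, fun i => i.elim⟩, by ext q; simp [paramCarrier]⟩

theorem FramedPoint.rescale_rescale (a b c d : ℝ) (q : FramedPoint S) :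
    (q.rescale a b).rescale c d = q.rescale (c * a) (c * b + d) := by
  simp only [FramedPoint.rescale, Prod.mk.injEq, true_and]
  constructor <;> ring

theorem FramedPoint.rescale_one_zero (q : FramedPoint S) : q.rescale 1 0 = q := by
  simp [FramedPoint.rescale]

/-- Smoothness of a moving rescaling of a moving framed link. -/
theorem contDiffOn_rescale {γ : ℝ × ℝ → FramedPoint S} {T : Set (ℝ × ℝ)}
    (hγ : ContDiffOn ℝ ∞ (fun p => (γ p).2) T) {a b : ℝ → ℝ} (ha : ContDiff ℝ ∞ a)
    (hb : ContDiff ℝ ∞ b) :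
    ContDiffOn ℝ ∞ (fun p => ((γ p).rescale (a p.1) (b p.1)).2) T := by
  have h1 : ContDiffOn ℝ ∞ (fun p => (γ p).2.1) T := contDiff_fst.comp_contDiffOn hγ
  have h2 : ContDiffOn ℝ ∞ (fun p => (γ p).2.2) T := contDiff_snd.comp_contDiffOn hγ
  have ha' : ContDiffOn ℝ ∞ (fun p : ℝ × ℝ => a p.1) T := (ha.comp contDiff_fst).contDiffOn
  have hb' : ContDiffOn ℝ ∞ (fun p : ℝ × ℝ => b p.1) T := (hb.comp contDiff_fst).contDiffOn
  exact ((ha'.mul h1).add hb').prodMk (ha'.mul h2)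

theorem IsFramedKnotParam.contMDiffOn_const {γ : ℝ → FramedPoint S} (hγ : IsFramedKnotParam γ)
    (T : Set (ℝ × ℝ)) :
    ContMDiffOn 𝓘(ℝ, ℝ × ℝ) (𝓡∂ 2).tangent ∞ (fun p : ℝ × ℝ => (γ p.2).1) T :=
  (hγ.smooth_horizontal.comp contDiff_snd.contMDiff).contMDiffOn

theorem IsFramedKnotParam.contDiffOn_const {γ : ℝ → FramedPoint S} (hγ : IsFramedKnotParam γ)
    (T : Set (ℝ × ℝ)) : ContDiffOn ℝ ∞ (fun p : ℝ × ℝ => (γ p.2).2) T :=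
  (hγ.smooth_vertical.comp contDiff_snd).contDiffOn

theorem Isotopic.superpose_right {K K' : FramedLink S} (h : Isotopic K K') (L : FramedLink S) :
    Isotopic (K.superpose L) (K'.superpose L) := by
  obtain ⟨ι, _, Γ, h1, h2, h3, h4, h5⟩ := h
  obtain ⟨κ, _, δ, hδ, hL⟩ := L.exists_param
  refine ⟨ι ⊕ κ, inferInstance, fun s => Sum.elim (fun i t => (Γ s i t).rescale (1 / 2) 0)
    (fun i t => (δ i t).rescale (1 / 2) (1 / 2)), ?_, ?_, ?_, ?_, ?_⟩
  · rintro (i | i)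
    · exact h1 i
    · exact (hδ.knot i).contMDiffOn_const _
  · rintro (i | i)
    · exact contDiffOn_rescale (γ := fun p => Γ p.1 i p.2) (h2 i) contDiff_const contDiff_const
    · exact contDiffOn_rescale (γ := fun p => δ i p.2) ((hδ.knot i).contDiffOn_const _)
        contDiff_const contDiff_const
  · intro s hs
    refine ((h3 s hs).rescale (by norm_num) (by norm_num) (by norm_num)).stack
      (hδ.rescale (by norm_num) (by norm_num) (by norm_num)) fun i j u t => ?_
    have e1 := ((h3 s hs).rescale_height (a := 1 / 2) (by norm_num) 0 i u).2
    have e2 := (hδ.rescale_height (a := 1 / 2) (by norm_num) (1 / 2) j t).1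
    linarith
  · rw [paramCarrier_elim, paramCarrier_rescale, paramCarrier_rescale, ← h4, ← hL]; rfl
  · rw [paramCarrier_elim, paramCarrier_rescale, paramCarrier_rescale, ← h5, ← hL]; rfl

theorem Isotopic.superpose_left {K K' : FramedLink S} (h : Isotopic K K') (L : FramedLink S) :
    Isotopic (L.superpose K) (L.superpose K') := by
  obtain ⟨ι, _, Γ, h1, h2, h3, h4, h5⟩ := h
  obtain ⟨κ, _, δ, hδ, hL⟩ := L.exists_param
  refine ⟨κ ⊕ ι, inferInstance, fun s => Sum.elim (fun i t => (δ i t).rescale (1 / 2) 0)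
    (fun i t => (Γ s i t).rescale (1 / 2) (1 / 2)), ?_, ?_, ?_, ?_, ?_⟩
  · rintro (i | i)
    · exact (hδ.knot i).contMDiffOn_const _
    · exact h1 i
  · rintro (i | i)
    · exact contDiffOn_rescale (γ := fun p => δ i p.2) ((hδ.knot i).contDiffOn_const _)
        contDiff_const contDiff_const
    · exact contDiffOn_rescale (γ := fun p => Γ p.1 i p.2) (h2 i) contDiff_const contDiff_const
  · intro s hs
    refine (hδ.rescale (by norm_num) (by norm_num) (by norm_num)).stack
      ((h3 s hs).rescale (by norm_num) (by norm_num) (by norm_num)) fun i j u t => ?_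
    have e1 := (hδ.rescale_height (a := 1 / 2) (by norm_num) 0 i u).2
    have e2 := ((h3 s hs).rescale_height (a := 1 / 2) (by norm_num) (1 / 2) j t).1
    linarith
  · rw [paramCarrier_elim, paramCarrier_rescale, paramCarrier_rescale, ← h4, ← hL]; rfl
  · rw [paramCarrier_elim, paramCarrier_rescale, paramCarrier_rescale, ← h5, ← hL]; rfl

theorem isotopic_superpose_assoc (K L M : FramedLink S) :
    Isotopic ((K.superpose L).superpose M) (K.superpose (L.superpose M)) := by
  obtain ⟨ι, _, γ, hγ, hK⟩ := K.exists_param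
  obtain ⟨κ, _, δ, hδ, hL⟩ := L.exists_param
  obtain ⟨μ, _, ε, hε, hM⟩ := M.exists_param
  refine ⟨ι ⊕ (κ ⊕ μ), inferInstance, fun s =>
    Sum.elim (fun i t => (γ i t).rescale ((1 + s) / 4) 0)
      (Sum.elim (fun i t => (δ i t).rescale (1 / 4) ((1 + s) / 4))
        (fun i t => (ε i t).rescale ((2 - s) / 4) ((2 + s) / 4))), ?_, ?_, ?_, ?_, ?_⟩
  · rintro (i | i | i)
    · exact (hγ.knot i).contMDiffOn_const _
    · exact (hδ.knot i).contMDiffOn_const _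
    · exact (hε.knot i).contMDiffOn_const _
  · rintro (i | i | i)
    · exact contDiffOn_rescale (γ := fun p => γ i p.2) (a := fun s => (1 + s) / 4)
        (b := fun _ => 0) ((hγ.knot i).contDiffOn_const _) (by fun_prop) (by fun_prop)
    · exact contDiffOn_rescale (γ := fun p => δ i p.2) (a := fun _ => 1 / 4)
        (b := fun s => (1 + s) / 4) ((hδ.knot i).contDiffOn_const _) (by fun_prop) (by fun_prop)
    · exact contDiffOn_rescale (γ := fun p => ε i p.2) (a := fun s => (2 - s) / 4)
        (b := fun s => (2 + s) / 4) ((hε.knot i).contDiffOn_const _) (by fun_prop) (by fun_prop)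
  · rintro s ⟨hs0, hs1⟩
    have p1 : 0 < (1 + s) / 4 := by linarith
    have p2 : 0 < (2 - s) / 4 := by linarith
    refine (hγ.rescale p1 le_rfl (by linarith)).stack
      ((hδ.rescale (by norm_num) p1.le (by linarith)).stack
        (hε.rescale p2 (by linarith) (by linarith)) fun i j u t => ?_) ?_
    · have e1 := (hδ.rescale_height (a := 1 / 4) (by norm_num) ((1 + s) / 4) i u).2
      have e2 := (hε.rescale_height p2 ((2 + s) / 4) j t).1
      linarith
    · rintro i (j | j) u t
      · have e1 := (hγ.rescale_height p1 0 i u).2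
        have e2 := (hδ.rescale_height (a := 1 / 4) (by norm_num) ((1 + s) / 4) j t).1
        simp only [Sum.elim_inl]
        linarith
      · have e1 := (hγ.rescale_height p1 0 i u).2
        have e2 := (hε.rescale_height p2 ((2 + s) / 4) j t).1
        simp only [Sum.elim_inr]
        linarith
  · simp only [paramCarrier_elim, paramCarrier_rescale, FramedLink.superpose, image_union,
      image_image, FramedPoint.rescale_rescale, ← hK, ← hL, ← hM, union_assoc]
    norm_num
  · simp only [paramCarrier_elim, paramCarrier_rescale, FramedLink.superpose, image_union,
      image_image, FramedPoint.rescale_rescale, ← hK, ← hL, ← hM]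
    norm_num

theorem isotopic_empty_superpose (K : FramedLink S) :
    Isotopic ((FramedLink.empty S).superpose K) K := by
  obtain ⟨ι, _, γ, hγ, hK⟩ := K.exists_param
  refine ⟨ι, inferInstance, fun s i t => (γ i t).rescale ((1 + s) / 2) ((1 - s) / 2),
    fun i => (hγ.knot i).contMDiffOn_const _, fun i => ?_, ?_, ?_, ?_⟩
  · exact contDiffOn_rescale (γ := fun p => γ i p.2) (a := fun s => (1 + s) / 2)
      (b := fun s => (1 - s) / 2) ((hγ.knot i).contDiffOn_const _) (by fun_prop) (by fun_prop)
  · rintro s ⟨hs0, hs1⟩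
    exact hγ.rescale (by linarith) (by linarith) (by linarith)
  · rw [paramCarrier_rescale, ← hK]
    simp [FramedLink.superpose, FramedLink.empty]
  · rw [paramCarrier_rescale, ← hK]
    norm_num [FramedPoint.rescale_one_zero]

theorem isotopic_superpose_empty (K : FramedLink S) :
    Isotopic (K.superpose (FramedLink.empty S)) K := by
  obtain ⟨ι, _, γ, hγ, hK⟩ := K.exists_param
  refine ⟨ι, inferInstance, fun s i t => (γ i t).rescale ((1 + s) / 2) 0,
    fun i => (hγ.knot i).contMDiffOn_const _, fun i => ?_, ?_, ?_, ?_⟩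
  · exact contDiffOn_rescale (γ := fun p => γ i p.2) (a := fun s => (1 + s) / 2)
      (b := fun _ => 0) ((hγ.knot i).contDiffOn_const _) (by fun_prop) (by fun_prop)
  · rintro s ⟨hs0, hs1⟩
    exact hγ.rescale (by linarith) le_rfl (by linarith)
  · rw [paramCarrier_rescale, ← hK]
    simp [FramedLink.superpose, FramedLink.empty]
  · rw [paramCarrier_rescale, ← hK]
    norm_num [FramedPoint.rescale_one_zero]

variable (S) in
/-- Isotopy classes of framed links in `S × [0,1]`. -/
def IsotopyClass : Type _ := Quot (Isotopic (S := S))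

/-- The isotopy class of a framed link. -/
def FramedLink.isotopyClass (K : FramedLink S) : IsotopyClass S := Quot.mk _ K

/-- Isotopy classes of framed links form a monoid under superposition. -/
instance : Monoid (IsotopyClass S) where
  mul := Quot.map₂ FramedLink.superpose (fun L _ _ h => h.superpose_left L)
    (fun _ _ L h => h.superpose_right L)
  one := Quot.mk _ (FramedLink.empty S)
  mul_assoc := by
    rintro ⟨K⟩ ⟨L⟩ ⟨M⟩
    exact Quot.sound (isotopic_superpose_assoc K L M)
  one_mul := by
    rintro ⟨K⟩
    exact Quot.sound (isotopic_empty_superpose K)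
  mul_one := by
    rintro ⟨K⟩
    exact Quot.sound (isotopic_superpose_empty K)

/-! ### The skein algebra -/

/-- The closed disk of radius `√2` in the plane; its boundary contains the points `(±1, ±1)`. -/
def modelDisk : Set Plane := {z | z 0 ^ 2 + z 1 ^ 2 ≤ 2}

/-- Above the disk `φ(modelDisk)`, the framing of the link `K` is vertical, and `K` consists of the
two strands that project to the arcs `φ ∘ a` and `φ ∘ b` with respective heights `k` and `l`. -/
def HasDiagramOver (K : FramedLink S) (φ : Plane → S) (a b : ℝ → Plane) (k l : ℝ → ℝ) : Prop :=
  (∀ q ∈ K.carrier, q.base ∈ φ '' modelDisk → q.IsVertical) ∧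
  {x : S × ℝ | ∃ q ∈ K.carrier, q.base ∈ φ '' modelDisk ∧ q.pos = x} =
    (fun s => (φ (a s), k s)) '' Icc (-1) 1 ∪ (fun s => (φ (b s), l s)) '' Icc (-1) 1

/-- A Kauffman triple: the framed links `K₁`, `K₀`, `K∞` coincide away from an embedded disk `D`
in the oriented surface `S`. Above `D`, they have vertical framing and are represented by diagrams:

* `K₁` is the crossing of the two diagonals of `D`, where the diagonal with positive slope passes
  over the other one;
* `K₀` is the resolution of this crossing into two arcs, a northern one joining the north-west and
  north-east corners, and a southern one joining the south-west and south-east corners;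
* `K∞` is the resolution into two arcs, an eastern and a western one, which join the north and
  south corners on their side. -/
def IsKauffmanTriple (o : SurfaceOrientation S)
    (K₁ K₀ Kinf : FramedLink S) : Prop :=
  ∃ φ : Plane → S,
    ContMDiff (𝓡 2) (𝓡∂ 2) ∞ φ ∧ Function.Injective φ ∧
    (∀ z, φ z ∈ (𝓡∂ 2).interior S) ∧
    (∀ z, 0 < ((o.sign (φ z) : ℤ) : ℝ) *
      ContinuousLinearMap.det (mfderiv (𝓡 2) (𝓡∂ 2) φ z : Plane →L[ℝ] Plane)) ∧
    {q ∈ K₁.carrier | q.base ∉ φ '' modelDisk} = {q ∈ K₀.carrier | q.base ∉ φ '' modelDisk} ∧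
    {q ∈ K₁.carrier | q.base ∉ φ '' modelDisk} = {q ∈ Kinf.carrier | q.base ∉ φ '' modelDisk} ∧
    (∃ k l : ℝ → ℝ, l 0 < k 0 ∧
      HasDiagramOver K₁ φ (fun s => !₂[s, s]) (fun s => !₂[s, -s]) k l) ∧
    (∃ f g k l : ℝ → ℝ, (∀ s ∈ Icc (-1 : ℝ) 1, 0 < f s ∧ 0 < g s) ∧
      f 1 = 1 ∧ f (-1) = 1 ∧ g 1 = 1 ∧ g (-1) = 1 ∧
      HasDiagramOver K₀ φ (fun s => !₂[s, f s]) (fun s => !₂[s, -g s]) k l) ∧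
    (∃ f g k l : ℝ → ℝ, (∀ s ∈ Icc (-1 : ℝ) 1, 0 < f s ∧ 0 < g s) ∧
      f 1 = 1 ∧ f (-1) = 1 ∧ g 1 = 1 ∧ g (-1) = 1 ∧
      HasDiagramOver Kinf φ (fun s => !₂[f s, s]) (fun s => !₂[-g s, s]) k l)

/-- The skein relation `K₁ = A⁻¹ K₀ + A K∞`, in the algebra that is freely spanned by isotopy
classes of framed links and is multiplied by superposition. -/
inductive SkeinRelation (A : ℂ) (o : SurfaceOrientation S) :
    MonoidAlgebra ℂ (IsotopyClass S) → MonoidAlgebra ℂ (IsotopyClass S) → Prop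
  | skein (K₁ K₀ Kinf : FramedLink S) (h : IsKauffmanTriple o K₁ K₀ Kinf) :
      SkeinRelation A o (MonoidAlgebra.of ℂ (IsotopyClass S) K₁.isotopyClass)
        (A⁻¹ • MonoidAlgebra.of ℂ (IsotopyClass S) K₀.isotopyClass +
          A • MonoidAlgebra.of ℂ (IsotopyClass S) Kinf.isotopyClass)

/-- The skein algebra `𝒮^A(S)` of the oriented surface `S`: the vector space freely generated by
framed links, modulo isotopy and the skein relation, multiplied by superposition. -/
abbrev SkeinAlgebra (A : ℂ) (o : SurfaceOrientation S) : Type _ :=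
  RingQuot (SkeinRelation A o)

/-- The skein `[K]` of a framed link. -/
def skein (A : ℂ) (o : SurfaceOrientation S) (K : FramedLink S) :
    SkeinAlgebra A o :=
  RingQuot.mkAlgHom ℂ (SkeinRelation A o) (MonoidAlgebra.of ℂ (IsotopyClass S) K.isotopyClass)

theorem skein_isotopic (A : ℂ) (o : SurfaceOrientation S) {K L : FramedLink S}
    (h : Isotopic K L) : skein A o K = skein A o L := by
  have : K.isotopyClass = L.isotopyClass := Quot.sound h
  rw [skein, this, skein]

theorem skein_superpose (A : ℂ) (o : SurfaceOrientation S) (K L : FramedLink S) :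
    skein A o (K.superpose L) = skein A o K * skein A o L := by
  have : (K.superpose L).isotopyClass = K.isotopyClass * L.isotopyClass := rfl
  rw [skein, this, map_mul, map_mul, skein, skein]

theorem skein_relation (A : ℂ) (o : SurfaceOrientation S) {K₁ K₀ Kinf : FramedLink S}
    (h : IsKauffmanTriple o K₁ K₀ Kinf) :
    skein A o K₁ = A⁻¹ • skein A o K₀ + A • skein A o Kinf := by
  rw [skein, RingQuot.mkAlgHom_rel ℂ (SkeinRelation.skein K₁ K₀ Kinf h), map_add, map_smul,
    map_smul, skein, skein]

/-! ### Framed knots -/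

variable (S) in
/-- A (parametrized) framed knot in `S × [0,1]`. -/
structure FramedKnot where
  toFun : ℝ → FramedPoint S
  isParam : IsFramedKnotParam toFun

/-- The framed link underlying a parametrized framed knot. -/
def FramedKnot.toLink (K : FramedKnot S) : FramedLink S where
  carrier := range K.toFun
  exists_param := ⟨Unit, inferInstance, fun _ => K.toFun,
    ⟨fun _ => K.isParam, fun _ _ _ _ _ => rfl⟩, by ext q; simp [paramCarrier]⟩

/-- The knot is represented by a simple closed curve in `S`, with vertical framing. -/
def FramedKnot.IsSimpleVertical (K : FramedKnot S) : Prop :=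
  (∀ t, (K.toFun t).IsVertical) ∧
    ∀ s t, (K.toFun s).base = (K.toFun t).base → ∃ n : ℤ, s - t = n

variable (S) in
/-- `C` is a connected component of the boundary of `S`. -/
def IsBoundaryComponent (C : Set S) : Prop :=
  ∃ x ∈ (𝓡∂ 2).boundary S, C = connectedComponentIn ((𝓡∂ 2).boundary S) x

/-- `P` is represented by a curve in the interior of `S` parallel to the boundary component `C`,
with vertical framing: there is a smoothly embedded annulus `Φ : [0,1] × ℝ/ℤ → S` with one boundary
curve equal to `C`, and the other one equal to the projection of `P`. -/
def FramedKnot.IsParallelTo (P : FramedKnot S) (C : Set S) : Prop :=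
  P.IsSimpleVertical ∧
  ∃ Φ : ℝ × ℝ → S,
    ContMDiffOn 𝓘(ℝ, ℝ × ℝ) (𝓡∂ 2) ∞ Φ (Icc (0 : ℝ) 1 ×ˢ univ) ∧
    (∀ s t, Φ (s, t + 1) = Φ (s, t)) ∧
    (∀ s ∈ Icc (0 : ℝ) 1, ∀ s' ∈ Icc (0 : ℝ) 1, ∀ t t', Φ (s, t) = Φ (s', t') →
      s = s' ∧ ∃ n : ℤ, t - t' = n) ∧
    (∀ p ∈ Icc (0 : ℝ) 1 ×ˢ univ, Function.Injective
      (mfderivWithin 𝓘(ℝ, ℝ × ℝ) (𝓡∂ 2) Φ (Icc (0 : ℝ) 1 ×ˢ univ) p)) ∧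
    (∀ s ∈ Ioc (0 : ℝ) 1, ∀ t, Φ (s, t) ∈ (𝓡∂ 2).interior S) ∧
    range (fun t => Φ (0, t)) = C ∧
    ∀ t, Φ (1, t) = (P.toFun t).base

end Surface

/-! ### Cohomology classes and spin structures -/

/-- A class in `H¹(X; ℤ/2) = Hom(H₁(X; ℤ), ℤ/2)`, described by its values on loops: these are
invariant under homotopy, additive, and independent of base points. -/
@[ext] structure H1Z2 (X : Type*) [TopologicalSpace X] where
  eval : ∀ {x : X}, Path x x → ZMod 2
  homotopic : ∀ {x : X} (p q : Path x x), p.Homotopic q → eval p = eval q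
  trans : ∀ {x : X} (p q : Path x x), eval (p.trans q) = eval p + eval q
  conj : ∀ {x y : X} (l : Path x x) (p : Path x y), eval (p.symm.trans (l.trans p)) = eval l

/-- The zero class. -/
instance H1Z2.instZero {X : Type*} [TopologicalSpace X] : Zero (H1Z2 X) where
  zero :=
    { eval := fun _ => 0
      homotopic := fun _ _ _ => rfl
      trans := fun _ _ => by simp
      conj := fun _ _ => rfl }

/-- Addition of classes. -/
instance H1Z2.instAdd {X : Type*} [TopologicalSpace X] : Add (H1Z2 X) where
  add α β :=
    { eval := fun l => α.eval l + β.eval l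
      homotopic := fun p q h => by rw [α.homotopic p q h, β.homotopic p q h]
      trans := fun p q => by rw [α.trans, β.trans]; ring
      conj := fun l p => by rw [α.conj, β.conj] }

/-- Pullback of a class by a continuous map. -/
def H1Z2.pullback {X Y : Type*} [TopologicalSpace X] [TopologicalSpace Y] (f : C(X, Y))
    (α : H1Z2 Y) : H1Z2 X where
  eval l := α.eval (l.map f.continuous)
  homotopic p q h := α.homotopic _ _ (h.map f)
  trans p q := by rw [Path.map_trans, α.trans]
  conj l p := by rw [Path.map_trans, Path.map_trans, ← Path.map_symm, α.conj]

section Spin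

variable (S : Type*) [TopologicalSpace S] [ChartedSpace (EuclideanHalfSpace 2) S]
  [IsManifold (𝓡∂ 2) ∞ S]

/-- The bundle over `S` of linearly independent pairs `(v₁, v₂)` of vectors of `T_x S ⊕ ℝ`, the
tangent space of the thickened surface. As `S` is oriented, `(v₁, v₂)` has a contractible space of
completions to an oriented frame, so that this bundle is homotopy equivalent to the bundle of
oriented frames of the thickened surface. -/
abbrev FrameBundle : Type _ :=
  {p : (TangentBundle (𝓡∂ 2) S × ℝ) × (TangentBundle (𝓡∂ 2) S × ℝ) //
    p.1.1.proj = p.2.1.proj ∧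
    LinearIndependent ℝ ![((p.1.1.2 : Plane), p.1.2), ((p.2.1.2 : Plane), p.2.2)]}

/-- The projection of the frame bundle to `S`. -/
def frameProj : C(FrameBundle S, S) where
  toFun p := p.1.1.1.proj
  continuous_toFun := (FiberBundle.continuous_proj Plane (TangentSpace (𝓡∂ 2))).comp
    (continuous_fst.comp (continuous_fst.comp continuous_subtype_val))

variable {S}

/-- The closed curve in a fibre of the frame bundle that makes one full turn around the vertical
direction; it generates the fundamental group `ℤ/2` of the fibre. -/
def fibreCurve (x : S) (e₁ e₂ : TangentSpace (𝓡∂ 2) x)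
    (h : LinearIndependent ℝ ![e₁, e₂]) (t : ℝ) : FrameBundle S :=
  ⟨((⟨x, Real.cos (2 * Real.pi * t) • e₁ + Real.sin (2 * Real.pi * t) • e₂⟩, 0), (⟨x, 0⟩, 1)),
    rfl, by
      rw [LinearIndependent.pair_iff] at h ⊢
      intro c d hcd
      have e1 : c • (Real.cos (2 * Real.pi * t) • e₁ + Real.sin (2 * Real.pi * t) • e₂) +
          d • (0 : TangentSpace (𝓡∂ 2) x) = 0 := congrArg Prod.fst hcd
      have e2 : c * 0 + d * 1 = (0 : ℝ) := congrArg Prod.snd hcd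
      have e3 := h (c * Real.cos (2 * Real.pi * t)) (c * Real.sin (2 * Real.pi * t)) (by
        rw [smul_zero, add_zero, smul_add, smul_smul, smul_smul] at e1
        exact e1)
      refine ⟨?_, by linarith⟩
      have := Real.cos_sq_add_sin_sq (2 * Real.pi * t)
      have : c * c = 0 := by
        calc c * c = (c * Real.cos (2 * Real.pi * t)) ^ 2 + (c * Real.sin (2 * Real.pi * t)) ^ 2 := by
              linear_combination -(c * c) * this
          _ = 0 := by rw [e3.1, e3.2]; ring
      exact mul_self_eq_zero.mp this⟩

theorem continuous_fibreCurve (x : S) (e₁ e₂ : TangentSpace (𝓡∂ 2) x)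
    (h : LinearIndependent ℝ ![e₁, e₂]) : Continuous (fibreCurve x e₁ e₂ h) := by
  refine Continuous.subtype_mk ?_ _
  refine Continuous.prodMk (Continuous.prodMk ?_ continuous_const) continuous_const
  have h1 : Continuous (fun t : ℝ => (Real.cos (2 * Real.pi * t) • (e₁ : Plane) +
      Real.sin (2 * Real.pi * t) • (e₂ : Plane) : Plane)) := by fun_prop
  exact (FiberBundle.continuous_totalSpaceMk Plane (TangentSpace (𝓡∂ 2)) x).comp h1

/-- The previous closed curve, as a loop. -/
def fibreLoop (x : S) (e₁ e₂ : TangentSpace (𝓡∂ 2) x) (h : LinearIndependent ℝ ![e₁, e₂]) :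
    Path (fibreCurve x e₁ e₂ h 0) (fibreCurve x e₁ e₂ h 0) where
  toFun t := fibreCurve x e₁ e₂ h t
  continuous_toFun := (continuous_fibreCurve x e₁ e₂ h).comp continuous_subtype_val
  source' := rfl
  target' := by
    apply Subtype.ext
    simp [fibreCurve]

variable (S) in
/-- An isotopy class of spin structures on `S`, or equivalently on the thickened surface: a double
covering of the frame bundle that is nontrivial over each fibre, described by its class in
`H¹( ; ℤ/2)`. -/
abbrev SpinStructure : Type _ :=
  {σ : H1Z2 (FrameBundle S) // ∀ x e₁ e₂ h, σ.eval (fibreLoop (S := S) x e₁ e₂ h) = 1}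

theorem FramedKnot.smooth_base (K : FramedKnot S) :
    ContMDiff 𝓘(ℝ, ℝ) (𝓡∂ 2) ∞ (fun t => (K.toFun t).base) :=
  (Bundle.contMDiff_proj (TangentSpace (𝓡∂ 2))).comp K.isParam.smooth_horizontal

/-- The frame formed by the velocity and the framing of a framed knot. -/
def FramedKnot.frame (K : FramedKnot S) (t : ℝ) : FrameBundle S :=
  ⟨((⟨(K.toFun t).base, mfderiv 𝓘(ℝ, ℝ) (𝓡∂ 2) (fun τ => (K.toFun τ).base) t (1 : ℝ)⟩,
      deriv (fun τ => (K.toFun τ).height) t),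
    ((K.toFun t).1, (K.toFun t).vertical)), rfl, K.isParam.framed t⟩

theorem FramedKnot.continuous_frame (K : FramedKnot S) : Continuous K.frame := by
  refine Continuous.subtype_mk ?_ _
  have hv := K.isParam.smooth_vertical
  have hh : ContDiff ℝ ∞ (fun τ => (K.toFun τ).height) := contDiff_fst.comp hv
  refine Continuous.prodMk (Continuous.prodMk ?_ ?_) (Continuous.prodMk ?_ ?_)
  · have h1 := K.smooth_base.continuous_tangentMap (by norm_num)
    have h2 : Continuous (fun t : ℝ => (⟨t, (1 : ℝ)⟩ : TangentBundle 𝓘(ℝ, ℝ) ℝ)) := by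
      have := (tangentBundleModelSpaceHomeomorph 𝓘(ℝ, ℝ)).symm.continuous
      exact this.comp (continuous_id.prodMk (continuous_const (y := (1 : ℝ))))
    exact h1.comp h2
  · exact hh.continuous_deriv (by norm_num)
  · exact K.isParam.smooth_horizontal.continuous
  · exact (contDiff_snd.comp hv).continuous

theorem FramedKnot.frame_one (K : FramedKnot S) : K.frame 1 = K.frame 0 := by
  have hper : (fun τ => (K.toFun (τ + 1))) = K.toFun := funext K.isParam.periodic
  have h1 : K.toFun 1 = K.toFun 0 := by simpa using K.isParam.periodic 0
  have hd : deriv (fun τ => (K.toFun τ).height) 1 = deriv (fun τ => (K.toFun τ).height) 0 := by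
    have := deriv_comp_add_const (fun τ => (K.toFun τ).height) 1 0
    simp only [K.isParam.periodic, zero_add] at this
    exact this.symm
  have ht : tangentMap 𝓘(ℝ, ℝ) (𝓡∂ 2) (fun τ => (K.toFun τ).base) ⟨1, (1 : ℝ)⟩ =
      tangentMap 𝓘(ℝ, ℝ) (𝓡∂ 2) (fun τ => (K.toFun τ).base) ⟨0, (1 : ℝ)⟩ := by
    have hc : MDifferentiable 𝓘(ℝ, ℝ) (𝓡∂ 2) (fun τ => (K.toFun τ).base) :=
      K.smooth_base.mdifferentiable (by norm_num)
    have hs : MDifferentiable 𝓘(ℝ, ℝ) 𝓘(ℝ, ℝ) (fun τ : ℝ => τ + 1) :=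
      (differentiable_id.add_const 1).mdifferentiable
    have h2 := tangentMap_comp_at (I := 𝓘(ℝ, ℝ)) (I' := 𝓘(ℝ, ℝ)) (I'' := 𝓡∂ 2)
      (⟨0, (1 : ℝ)⟩ : TangentBundle 𝓘(ℝ, ℝ) ℝ) (hc _) (hs _)
    have h3 : ((fun τ => (K.toFun τ).base) ∘ fun τ : ℝ => τ + 1) =
        fun τ => (K.toFun τ).base := by
      funext τ; simp [K.isParam.periodic]
    have h4 : tangentMap 𝓘(ℝ, ℝ) 𝓘(ℝ, ℝ) (fun τ : ℝ => τ + 1)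
        (⟨0, (1 : ℝ)⟩ : TangentBundle 𝓘(ℝ, ℝ) ℝ) = ⟨1, (1 : ℝ)⟩ := by
      have h5 : HasFDerivAt (fun τ : ℝ => τ + 1) (ContinuousLinearMap.id ℝ ℝ) 0 :=
        (hasFDerivAt_id (0 : ℝ)).add_const 1
      simp only [tangentMap, mfderiv_eq_fderiv, h5.fderiv]
      congr 1
      exact zero_add 1
    rw [h3, h4] at h2
    exact h2.symm
  apply Subtype.ext
  refine Prod.ext (Prod.ext ht hd) (Prod.ext ?_ ?_)
  · exact congrArg (fun q : FramedPoint S => q.1) h1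
  · exact congrArg FramedPoint.vertical h1

/-- The loop of frames along a framed knot. -/
def FramedKnot.frameLoop (K : FramedKnot S) : Path (K.frame 0) (K.frame 0) where
  toFun t := K.frame t
  continuous_toFun := K.continuous_frame.comp continuous_subtype_val
  source' := rfl
  target' := K.frame_one

/-- The loop in `S` that is the projection of a framed knot. -/
def FramedKnot.loop (K : FramedKnot S) : Path (K.toFun 0).base (K.toFun 0).base where
  toFun t := (K.toFun t).base
  continuous_toFun := K.smooth_base.continuous.comp continuous_subtype_val
  source' := rfl
  target' := by
    have h1 : K.toFun 1 = K.toFun 0 := by simpa using K.isParam.periodic 0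
    exact congrArg FramedPoint.base h1

/-- The monodromy `σ(K) ∈ ℤ/2` of the framing of `K` with respect to the spin structure `σ`. It is
normalized to be `0` when `K` is the boundary of a disk in `S`, with vertical framing, in which case
the frame formed by velocity and framing makes one full turn around the vertical direction. -/
def SpinStructure.monodromy (σ : SpinStructure S) (K : FramedKnot S) : ZMod 2 :=
  σ.1.eval K.frameLoop + 1

/-- The sign `(-1)^z`, for `z ∈ ℤ/2`. -/
def signOf (z : ZMod 2) : ℂ := (-1) ^ z.val

theorem signOf_add (z w : ZMod 2) : signOf (z + w) = signOf z * signOf w := by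
  have h : ∀ z : ZMod 2, z = 0 ∨ z = 1 := by decide
  have h0 : signOf 0 = 1 := by simp [signOf]
  have h1 : signOf 1 = -1 := by simp [signOf, ZMod.val_one]
  have h2 : (1 + 1 : ZMod 2) = 0 := by decide
  rcases h z with rfl | rfl <;> rcases h w with rfl | rfl <;> simp [h0, h1, h2]

theorem signOf_mul_self (z : ZMod 2) : signOf z * signOf z = 1 := by
  simp only [signOf]
  rw [← mul_pow]; simp

/-! ### Spinned homomorphisms -/

/-- Pairs `(r, σ)` of a homomorphism `r : π₁(S) → SL₂(ℂ)` and of a spin structure `σ`. -/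
abbrev SpinPair (x₀ : S) : Type _ := (FundamentalGroup S x₀ →* SL(2, ℂ)) × SpinStructure S

/-- The trace of `r` on a loop. -/
def loopTrace {x₀ : S} (r : FundamentalGroup S x₀ →* SL(2, ℂ)) (l : Path x₀ x₀) : ℂ :=
  Matrix.trace (r (FundamentalGroup.fromPath (Path.Homotopic.Quotient.mk l)) : Matrix (Fin 2) (Fin 2) ℂ)

/-- Two pairs `(r, σ)`, `(r', σ')` define the same spinned homomorphism when there is a class
`α ∈ H¹(S; ℤ/2)` such that `r'` and `(-1)^α r` represent the same element of the `SL₂(ℂ)`-character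
variety of `S`, namely have the same traces, and such that `σ'` is obtained by modifying `σ` by
`α`. -/
instance spinPairSetoid (x₀ : S) : Setoid (SpinPair x₀) where
  r a b := ∃ α : H1Z2 S,
    (∀ l : Path x₀ x₀, loopTrace b.1 l = signOf (α.eval l) * loopTrace a.1 l) ∧
    b.2.1 = a.2.1 + α.pullback (frameProj S)
  iseqv :=
    { refl := fun a => ⟨0, fun l => by
          change _ = signOf 0 * _
          simp [signOf], by
          ext x l
          change _ = a.2.1.eval l + 0
          simp⟩
      symm := by
        rintro a b ⟨α, h1, h2⟩
        refine ⟨α, fun l => ?_, ?_⟩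
        · rw [h1, ← mul_assoc, signOf_mul_self, one_mul]
        · rw [h2]
          ext x l
          change _ = (a.2.1.eval l + α.eval _) + α.eval _
          rw [add_assoc, CharTwo.add_self_eq_zero, add_zero]
      trans := by
        rintro a b c ⟨α, h1, h2⟩ ⟨β, h3, h4⟩
        refine ⟨α + β, fun l => ?_, ?_⟩
        · change _ = signOf (α.eval l + β.eval l) * _
          rw [h3, h1, signOf_add]; ring
        · rw [h4, h2]
          ext x l
          change (a.2.1.eval l + α.eval _) + β.eval _ = a.2.1.eval l + (α.eval _ + β.eval _)
          rw [add_assoc] }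

/-- Spinned homomorphisms from `π₁(S)` to `PSL₂(ℂ)`, namely elements of
`(ℛ_{SL₂(ℂ)}(S) × Spin(S)) / H¹(S; ℤ/2)`, where `ℛ_{SL₂(ℂ)}(S)` is the character variety. -/
def SpinnedHom (x₀ : S) : Type _ := Quotient (spinPairSetoid x₀)

/-- The loop based at `x₀` that is obtained by joining the framed knot `K` to `x₀`. -/
def FramedKnot.basedLoop [PathConnectedSpace S] (x₀ : S) (K : FramedKnot S) : Path x₀ x₀ :=
  (PathConnectedSpace.somePath (K.toFun 0).base x₀).symm.trans
    (K.loop.trans (PathConnectedSpace.somePath (K.toFun 0).base x₀))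

/-- The trace `(-1)^{σ(K)} Tr r̂(K)` of a framed knot `K` with respect to the spinned homomorphism
represented by `(r̂, σ)`. -/
def SpinnedHom.trace [PathConnectedSpace S] {x₀ : S} (r : SpinnedHom x₀) (K : FramedKnot S) : ℂ :=
  Quotient.lift
    (fun a : SpinPair x₀ => signOf (a.2.monodromy K) * loopTrace a.1 (K.basedLoop x₀))
    (by
      rintro a b ⟨α, h1, h2⟩
      have e1 : b.2.monodromy K = a.2.monodromy K + α.eval (K.basedLoop x₀) := by
        have e2 : α.eval (K.basedLoop x₀) = α.eval K.loop := α.conj _ _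
        have e3 : b.2.1.eval K.frameLoop = a.2.1.eval K.frameLoop + α.eval K.loop := by
          rw [h2]; rfl
        simp only [SpinStructure.monodromy, e2, e3]
        ring
      change signOf _ * loopTrace _ _ = signOf _ * loopTrace _ _
      rw [e1, h1, signOf_add]
      linear_combination (-signOf (a.2.monodromy K) * loopTrace a.1 (K.basedLoop x₀)) *
        signOf_mul_self (α.eval (K.basedLoop x₀))) r

end Spin

/-! ### Representations of the skein algebra and their invariants -/

/-- A representation `ρ : 𝒜 → End(V)` is irreducible when `V` is nonzero and has no invariant
subspace except `0` and `V`. -/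
def IsIrreducibleRep {𝒜 V : Type*} [Ring 𝒜] [Algebra ℂ 𝒜] [AddCommGroup V] [Module ℂ V]
    (ρ : 𝒜 →ₐ[ℂ] Module.End ℂ V) : Prop :=
  Nontrivial V ∧ ∀ W : Submodule ℂ V, (∀ a, ∀ v ∈ W, ρ a v ∈ W) → W = ⊥ ∨ W = ⊤

section Invariants

variable {S : Type*} [TopologicalSpace S] [ChartedSpace (EuclideanHalfSpace 2) S]
  [IsManifold (𝓡∂ 2) ∞ S]

/-- The normalized Chebyshev polynomial of the first kind: `T₀ = 2`, `T₁ = x`, and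
`T_{n+1} = x T_n - T_{n-1}`, so that `Tr(Mⁿ) = T_n(Tr M)` for every `M ∈ SL₂(ℂ)`. -/
def chebyshev (n : ℕ) : Polynomial ℂ := Polynomial.Chebyshev.C ℂ n

/-- An algebra homomorphism on the skein algebra is non-trivial when it is nonzero on the skein of
some non-empty link. -/
def IsNontrivialHom {A : ℂ} {o : SurfaceOrientation S} {ℬ : Type*} [Ring ℬ] [Algebra ℂ ℬ]
    (κ : SkeinAlgebra A o →ₐ[ℂ] ℬ) : Prop :=
  ∃ K : FramedLink S, K.carrier.Nonempty ∧ κ (skein A o K) ≠ 0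

variable {A : ℂ} {o : SurfaceOrientation S} {V : Type*} [AddCommGroup V] [Module ℂ V]

/-- `κ : 𝒮¹(S) → ℂ` is the algebra homomorphism `κ_ρ` associated to `ρ : 𝒮^A(S) → End(V)`: it
sends each simple closed curve `K` with vertical framing to the number `κ_ρ(K)` such that
`ρ(T_N([K])) = κ_ρ(K) Id_V`. -/
def IsChebyshevHom (N : ℕ) (ρ : SkeinAlgebra A o →ₐ[ℂ] Module.End ℂ V)
    (κ : SkeinAlgebra 1 o →ₐ[ℂ] ℂ) : Prop :=
  ∀ K : FramedKnot S, K.IsSimpleVertical →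
    ρ (Polynomial.aeval (skein A o K.toLink) (chebyshev N)) =
      κ (skein 1 o K.toLink) • LinearMap.id

/-- The spinned homomorphism `r` is the classical shadow of `ρ`: the homomorphism
`κ_ρ : 𝒮¹(S) → ℂ` is non-trivial, and `r` is the spinned homomorphism that corresponds to it, in
the sense that `κ_ρ([K]) = - Tr r(K)` for every framed knot `K`. -/
def IsClassicalShadow [PathConnectedSpace S] (N : ℕ)
    (ρ : SkeinAlgebra A o →ₐ[ℂ] Module.End ℂ V) {x₀ : S} (r : SpinnedHom x₀) : Prop :=
  ∃ κ : SkeinAlgebra 1 o →ₐ[ℂ] ℂ, IsChebyshevHom N ρ κ ∧ IsNontrivialHom κ ∧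
    ∀ K : FramedKnot S, κ (skein 1 o K.toLink) = -r.trace K

/-- `p` is the puncture invariant of `ρ` that is associated to the curve `P` parallel to a
boundary component. -/
def IsPunctureInvariant (ρ : SkeinAlgebra A o →ₐ[ℂ] Module.End ℂ V) (P : FramedKnot S)
    (p : ℂ) : Prop :=
  ρ (skein A o P.toLink) = p • LinearMap.id

end Invariants

end KauffmanSkein

end

set_option linter.unusedSectionVars false

/-! The skein of a curve `P` parallel to a boundary component is central, so Schur's lemma makes it
act by a scalar `p`; evaluating the defining property of `κ_ρ` on `P` then gives `T_N(p)`.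

Centrality is geometric and already holds among isotopy classes of links, before any skein relation
is imposed. A given link `L` projects to a compact subset of the interior of `S`. The annulus
between `P` and the boundary lets `P` slide, with vertical framing, to a curve so close to the
boundary that its projection misses that of `L` (`Collar.isotopic_knot`,
`Collar.exists_curve_disjoint`). Links with disjoint projections can exchange heights without
meeting, hence commute under superposition (`isotopic_superpose_comm`). How far `P` must slide
depends on `L`, but its isotopy class does not. Linearity and passage to the quotient extend
commutation to the whole skein algebra (`skein_commute`).

With `ρ([P]) = p Id`, one has `ρ(T_N([P])) = T_N(p) Id`, and since `V ≠ 0` the scalars can be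
compared: `T_N(p) = κ_ρ([P]) = -Tr r(P)`. The set of candidates for `p` is a fibre of `T_N`, finite
because `T_N` takes the distinct values `2` and `-2` when `N` is odd. -/

namespace KauffmanSkein

/-! ### Shadows of links, and commutation of links with disjoint shadows -/

section Isotopy

variable {S : Type*} [TopologicalSpace S] [ChartedSpace (EuclideanHalfSpace 2) S]
  [IsManifold (𝓡∂ 2) ∞ S]

/-- The set of points of `S` below a framed link. -/
def FramedLink.shadow (L : FramedLink S) : Set S := FramedPoint.base '' L.carrier

theorem IsFramedKnotParam.range_eq_image_Icc {γ : ℝ → FramedPoint S} (hγ : IsFramedKnotParam γ) :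
    range γ = γ '' Icc 0 1 := by
  have hper : Function.Periodic γ 1 := hγ.periodic
  have h := hper.image_Icc one_pos 0
  rw [zero_add] at h
  exact h.symm

theorem IsFramedKnotParam.continuous_base {γ : ℝ → FramedPoint S} (hγ : IsFramedKnotParam γ) :
    Continuous fun t => (γ t).base :=
  (FiberBundle.continuous_proj Plane (TangentSpace (𝓡∂ 2))).comp hγ.smooth_horizontal.continuous

/-- By periodicity each component is covered by one period `[0,1]`, and there are finitely many
components. -/
theorem FramedLink.isCompact_shadow (L : FramedLink S) : IsCompact L.shadow := by
  obtain ⟨ι, _, γ, hγ, hL⟩ := L.exists_param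
  have h : L.shadow = ⋃ i, (fun t => (γ i t).base) '' Icc 0 1 := by
    have h1 : L.carrier = ⋃ i, γ i '' Icc 0 1 := by
      rw [hL]
      simp only [← fun i => (hγ.knot i).range_eq_image_Icc]
      ext q
      simp [paramCarrier]
    rw [FramedLink.shadow, h1, image_iUnion]
    simp only [image_image]
  rw [h]
  exact isCompact_iUnion fun i => isCompact_Icc.image (hγ.knot i).continuous_base

theorem FramedLink.shadow_subset_interior (L : FramedLink S) :
    L.shadow ⊆ (𝓡∂ 2).interior S := by
  obtain ⟨ι, _, γ, hγ, hL⟩ := L.exists_param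
  rintro _ ⟨q, hq, rfl⟩
  rw [hL] at hq
  obtain ⟨i, t, rfl⟩ := hq
  exact ((hγ.knot i).interior t).1

/-- Two framed links with disjoint projections to `S` can be moved vertically past each other. -/
theorem isotopic_superpose_comm {K L : FramedLink S} (h : Disjoint K.shadow L.shadow) :
    Isotopic (K.superpose L) (L.superpose K) := by
  obtain ⟨ι, _, γ, hγ, hK⟩ := K.exists_param
  obtain ⟨κ, _, δ, hδ, hL⟩ := L.exists_param
  have hne : ∀ i j s t, (γ i s).base ≠ (δ j t).base := fun i j s t e =>
    disjoint_left.mp h ⟨γ i s, hK ▸ ⟨i, s, rfl⟩, rfl⟩ ⟨δ j t, hL ▸ ⟨j, t, rfl⟩, e.symm⟩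
  -- The slab of `K` rises from `[0,1/2]` to `[1/2,1]` while that of `L` descends the other way. The
  -- slabs overlap during the motion, so disjointness has to come from the projections to `S`, never
  -- from heights.
  refine ⟨ι ⊕ κ, inferInstance, fun s => Sum.elim (fun i t => (γ i t).rescale (1 / 2) (s / 2))
    (fun j t => (δ j t).rescale (1 / 2) ((1 - s) / 2)), ?_, ?_, ?_, ?_, ?_⟩
  · rintro (i | j)
    · exact (hγ.knot i).contMDiffOn_const _
    · exact (hδ.knot j).contMDiffOn_const _
  · rintro (i | j)
    · exact contDiffOn_rescale (γ := fun p => γ i p.2) (a := fun _ => 1 / 2)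
        (b := fun s => s / 2) ((hγ.knot i).contDiffOn_const _) (by fun_prop) (by fun_prop)
    · exact contDiffOn_rescale (γ := fun p => δ j p.2) (a := fun _ => 1 / 2)
        (b := fun s => (1 - s) / 2) ((hδ.knot j).contDiffOn_const _) (by fun_prop) (by fun_prop)
  · rintro s ⟨hs0, hs1⟩
    have hγ' := hγ.rescale (a := 1 / 2) (b := s / 2) (by norm_num) (by linarith) (by linarith)
    have hδ' := hδ.rescale (a := 1 / 2) (b := (1 - s) / 2) (by norm_num) (by linarith)
      (by linarith)
    refine ⟨?_, ?_⟩
    · rintro (i | j)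
      · exact hγ'.knot i
      · exact hδ'.knot j
    · rintro (i | i) (j | j) u t e
      · exact congrArg _ (hγ'.disjoint i j u t e)
      · exact absurd (congrArg Prod.fst e) (hne i j u t)
      · exact absurd (congrArg Prod.fst e).symm (hne j i t u)
      · exact congrArg _ (hδ'.disjoint i j u t e)
  · simp [paramCarrier_elim, paramCarrier_rescale, FramedLink.superpose, ← hK, ← hL]
  · simp [paramCarrier_elim, paramCarrier_rescale, FramedLink.superpose, ← hK, ← hL, union_comm]

/-! ### Sliding a curve along an embedded annulus -/

variable (S) in
/-- A smoothly embedded annulus in `S`, parametrized by `[0,1] × ℝ/ℤ`, that is contained in the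
interior of `S` except possibly for its boundary curve `{0} × ℝ/ℤ`. -/
structure Collar where
  toFun : ℝ × ℝ → S
  smooth : ContMDiffOn 𝓘(ℝ, ℝ × ℝ) (𝓡∂ 2) ∞ toFun (Icc (0 : ℝ) 1 ×ˢ univ)
  periodic : ∀ s t, toFun (s, t + 1) = toFun (s, t)
  injective : ∀ s ∈ Icc (0 : ℝ) 1, ∀ s' ∈ Icc (0 : ℝ) 1, ∀ t t', toFun (s, t) = toFun (s', t') →
      s = s' ∧ ∃ n : ℤ, t - t' = n
  immersion : ∀ p ∈ Icc (0 : ℝ) 1 ×ˢ univ, Function.Injective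
      (mfderivWithin 𝓘(ℝ, ℝ × ℝ) (𝓡∂ 2) toFun (Icc (0 : ℝ) 1 ×ˢ univ) p)
  interior : ∀ s ∈ Ioc (0 : ℝ) 1, ∀ t, toFun (s, t) ∈ (𝓡∂ 2).interior S

namespace Collar

variable (Φ : Collar S)

/-- Smoothness of the annulus is only known within the closed strip, but a whole line `{s} × ℝ`
stays in the strip, so the chain rule yields a genuine derivative, even for `s = 0` or `s = 1`. -/
theorem hasMFDerivAt_curve {s : ℝ} (hs : s ∈ Icc (0 : ℝ) 1) (t : ℝ) :
    HasMFDerivAt 𝓘(ℝ, ℝ) (𝓡∂ 2) (fun τ => Φ.toFun (s, τ)) t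
      ((mfderivWithin 𝓘(ℝ, ℝ × ℝ) (𝓡∂ 2) Φ.toFun (Icc (0 : ℝ) 1 ×ˢ univ) (s, t)).comp
        (ContinuousLinearMap.inr ℝ ℝ ℝ)) := by
  have h1 := ((Φ.smooth (s, t) ⟨hs, mem_univ _⟩).mdifferentiableWithinAt
    (by norm_num)).hasMFDerivWithinAt
  have h2 : HasMFDerivAt 𝓘(ℝ, ℝ) 𝓘(ℝ, ℝ × ℝ) (fun τ : ℝ => (s, τ)) t
      (ContinuousLinearMap.inr ℝ ℝ ℝ) :=
    ((hasFDerivAt_const s t).prodMk (hasFDerivAt_id t)).hasMFDerivAt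
  exact hasMFDerivWithinAt_univ.mp
    (h1.comp t (hasMFDerivWithinAt_univ.mpr h2) fun τ _ => ⟨hs, mem_univ _⟩)

theorem mfderiv_curve_ne_zero {s : ℝ} (hs : s ∈ Icc (0 : ℝ) 1) (t : ℝ) :
    (mfderiv 𝓘(ℝ, ℝ) (𝓡∂ 2) (fun τ => Φ.toFun (s, τ)) t (1 : ℝ) : Plane) ≠ 0 := by
  rw [(Φ.hasMFDerivAt_curve hs t).mfderiv]
  intro h
  -- The velocity is the image of `(0, 1)` under the injective differential of the annulus; if it
  -- vanished, `(0, 1)` and `(0, 0)` would have the same image.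
  have h1 := Φ.immersion (s, t) ⟨hs, mem_univ _⟩
    (a₁ := ((0 : ℝ), (1 : ℝ))) (a₂ := ((0 : ℝ), (0 : ℝ)))
    (h.trans (ContinuousLinearMap.map_zero _).symm)
  simpa using congrArg Prod.snd h1

/-- The smooth lift of the annulus to the tangent bundle of `S` by the zero section. -/
theorem smooth_zero :
    ContMDiffOn 𝓘(ℝ, ℝ × ℝ) (𝓡∂ 2).tangent ∞
      (fun p => (⟨Φ.toFun p, 0⟩ : TangentBundle (𝓡∂ 2) S)) (Icc (0 : ℝ) 1 ×ˢ univ) :=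
  (Bundle.contMDiff_zeroSection ℝ (TangentSpace (𝓡∂ 2) : S → Type _)).comp_contMDiffOn Φ.smooth

/-- The curve `{s} × ℝ/ℤ`, with vertical framing and heights borrowed from a knot `P`. -/
noncomputable def curve (P : FramedKnot S) (s t : ℝ) : FramedPoint S :=
  (⟨Φ.toFun (s, t), 0⟩, (P.toFun t).2)

/-- The projection to `S` is already embedded and immersed, so the heights taken from `P` cannot
create self-intersections. The value `s = 0` is excluded because that curve may lie on the boundary
of `S`. -/
theorem isFramedKnotParam_curve {P : FramedKnot S} (hP : P.IsSimpleVertical) {s : ℝ}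
    (hs : s ∈ Ioc (0 : ℝ) 1) : IsFramedKnotParam (Φ.curve P s) where
  smooth_horizontal := by
    have h : ContMDiff 𝓘(ℝ, ℝ) 𝓘(ℝ, ℝ × ℝ) ∞ (fun t : ℝ => (s, t)) :=
      (contDiff_const.prodMk contDiff_id).contMDiff
    exact Φ.smooth_zero.comp_contMDiff h fun t => ⟨Ioc_subset_Icc_self hs, mem_univ _⟩
  smooth_vertical := P.isParam.smooth_vertical
  periodic t := by
    have h : (P.toFun (t + 1)).2 = (P.toFun t).2 := by rw [P.isParam.periodic]
    refine Prod.ext ?_ h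
    exact congrArg (fun x => (⟨x, (0 : Plane)⟩ : TangentBundle (𝓡∂ 2) S)) (Φ.periodic s t)
  interior t := ⟨Φ.interior s hs t, (P.isParam.interior t).2⟩
  embedded t t' h :=
    (Φ.injective s (Ioc_subset_Icc_self hs) s (Ioc_subset_Icc_self hs) t t'
      (congrArg Prod.fst h)).2
  framed t := by
    rw [LinearIndependent.pair_iff]
    intro c d hcd
    -- The framing has no horizontal component while the velocity has a nonzero one, `w`; this kills
    -- `c`, and the positive vertical component of the framing then kills `d`.
    let w : Plane := mfderiv 𝓘(ℝ, ℝ) (𝓡∂ 2) (fun τ => Φ.toFun (s, τ)) t (1 : ℝ)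
    have e1 : c • w + d • (0 : Plane) = 0 := congrArg Prod.fst hcd
    have e2 : c * deriv (fun τ => (P.toFun τ).height) t + d * (P.toFun t).vertical = 0 :=
      congrArg Prod.snd hcd
    rw [smul_zero, add_zero] at e1
    have hc := (smul_eq_zero.mp e1).resolve_right
      (Φ.mfderiv_curve_ne_zero (Ioc_subset_Icc_self hs) t)
    rw [hc, zero_mul, zero_add] at e2
    exact ⟨hc, (mul_eq_zero.mp e2).resolve_right (hP.1 t).2.ne'⟩

/-- The framed knot that is represented by the curve `{s} × ℝ/ℤ`. -/
noncomputable def knot {P : FramedKnot S} (hP : P.IsSimpleVertical) {s : ℝ} (hs : s ∈ Ioc (0 : ℝ) 1) :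
    FramedKnot S :=
  ⟨Φ.curve P s, Φ.isFramedKnotParam_curve hP hs⟩

/-- The curves `{u} × ℝ/ℤ`, for `u` decreasing from `1` to `ε`, are all framed knots with the
heights of `P`, so they form the isotopy. -/
theorem isotopic_knot {P : FramedKnot S} (hP : P.IsSimpleVertical)
    (hΦ : ∀ t, Φ.toFun (1, t) = (P.toFun t).base) {ε : ℝ} (hε : ε ∈ Ioc (0 : ℝ) 1) :
    Isotopic P.toLink (Φ.knot hP hε).toLink := by
  have hmem : ∀ s ∈ Icc (0 : ℝ) 1, 1 - s * (1 - ε) ∈ Ioc (0 : ℝ) 1 := by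
    rintro s ⟨h0, h1⟩
    obtain ⟨h2, h3⟩ := hε
    constructor <;> nlinarith
  -- As the framing of `P` is vertical, its horizontal part is zero, as on `Φ.curve`; the isotopy
  -- therefore starts exactly at `P`.
  have hP1 : Φ.curve P 1 = P.toFun := by
    funext t
    refine Prod.ext ?_ rfl
    have h := (hP.1 t).1
    change (⟨Φ.toFun (1, t), 0⟩ : TangentBundle (𝓡∂ 2) S) = (P.toFun t).1
    rw [hΦ]
    exact congrArg (fun v => (⟨(P.toFun t).base, v⟩ : TangentBundle (𝓡∂ 2) S)) h.symm
  refine ⟨Unit, inferInstance, fun s _ => Φ.curve P (1 - s * (1 - ε)), fun _ => ?_, fun _ => ?_,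
    fun s hs => ⟨fun _ => Φ.isFramedKnotParam_curve hP (hmem s hs), fun _ _ _ _ _ => rfl⟩, ?_, ?_⟩
  · have h : ContMDiff 𝓘(ℝ, ℝ × ℝ) 𝓘(ℝ, ℝ × ℝ) ∞
        (fun p : ℝ × ℝ => (1 - p.1 * (1 - ε), p.2)) := by
      apply ContDiff.contMDiff
      fun_prop
    exact Φ.smooth_zero.comp h.contMDiffOn fun p hp =>
      ⟨Ioc_subset_Icc_self (hmem p.1 hp.1), mem_univ _⟩
  · exact P.isParam.contDiffOn_const _
  · ext q
    simp [paramCarrier, FramedKnot.toLink, hP1]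
  · ext q
    simp [paramCarrier, FramedKnot.toLink, knot]

/-- Sufficiently close to `{0} × ℝ/ℤ`, the annulus avoids any compact subset of the interior. -/
theorem exists_curve_disjoint [T2Space S] {K : Set S} (hK : IsCompact K)
    (h0 : ∀ t, Φ.toFun (0, t) ∉ K) :
    ∃ ε ∈ Ioc (0 : ℝ) 1, ∀ t, Φ.toFun (ε, t) ∉ K := by
  have hQ : IsCompact (Icc (0 : ℝ) 1 ×ˢ Icc (0 : ℝ) 1) := isCompact_Icc.prod isCompact_Icc
  have hcont : ContinuousOn Φ.toFun (Icc (0 : ℝ) 1 ×ˢ Icc (0 : ℝ) 1) :=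
    Φ.smooth.continuousOn.mono (prod_mono_right (subset_univ _))
  -- The parameters `s` whose curve meets `K` within one period form the projection of a compact
  -- set. They are thus a closed set, which omits `0` and hence a neighbourhood of `0`.
  have hZ := (hQ.of_isClosed_subset (hcont.preimage_isClosed_of_isClosed hQ.isClosed hK.isClosed)
    inter_subset_left).image continuous_fst
  have hmem : (0 : ℝ) ∉ Prod.fst '' (Icc (0 : ℝ) 1 ×ˢ Icc (0 : ℝ) 1 ∩ Φ.toFun ⁻¹' K) := by
    rintro ⟨⟨s, t⟩, ⟨-, h⟩, rfl⟩
    exact h0 t h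
  obtain ⟨δ, hδ, hball⟩ := Metric.isOpen_iff.mp hZ.isClosed.isOpen_compl 0 hmem
  have hε : min (δ / 2) 1 ∈ Ioc (0 : ℝ) 1 := ⟨lt_min (half_pos hδ) one_pos, min_le_right _ _⟩
  refine ⟨min (δ / 2) 1, hε, fun t ht => ?_⟩
  -- Only `t` in `[0,1]` was covered by the compactness argument; periodicity brings any other `t`
  -- back there.
  have hper : Function.Periodic (fun t => Φ.toFun (min (δ / 2) 1, t)) 1 := Φ.periodic _
  obtain ⟨t', ht', e⟩ := hper.exists_mem_Ico₀ one_pos t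
  refine hball (a := min (δ / 2) 1) ?_
    ⟨(min (δ / 2) 1, t'), ⟨⟨Ioc_subset_Icc_self hε, Ico_subset_Icc_self ht'⟩, ?_⟩, rfl⟩
  · rw [Metric.mem_ball, Real.dist_0_eq_abs, abs_of_pos hε.1]
    exact (min_le_left _ _).trans_lt (half_lt_self hδ)
  · exact (congrArg (· ∈ K) e).mp ht

end Collar

/-! ### Centrality of boundary-parallel curves -/

/-- A curve parallel to a boundary component is central in the monoid of isotopy classes. -/
theorem FramedKnot.IsParallelTo.isotopyClass_comm [T2Space S] {C : Set S}
    (hC : IsBoundaryComponent S C) {P : FramedKnot S} (hP : P.IsParallelTo C)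
    (c : IsotopyClass S) : P.toLink.isotopyClass * c = c * P.toLink.isotopyClass := by
  obtain ⟨L⟩ := c
  obtain ⟨hv, Φ, h1, h2, h3, h4, h5, h6, h7⟩ := hP
  obtain ⟨x, -, rfl⟩ := hC
  let Ψ : Collar S := ⟨Φ, h1, h2, h3, h4, h5⟩
  -- The initial curve of the annulus lies in the boundary of `S`, and the projection of `L` in the
  -- interior.
  have h0 : ∀ t, Ψ.toFun (0, t) ∉ L.shadow := fun t ht =>
    disjoint_left.mp (ModelWithCorners.disjoint_interior_boundary (I := 𝓡∂ 2) (M := S))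
      (L.shadow_subset_interior ht)
      (connectedComponentIn_subset _ _ (h6 ▸ mem_range_self (f := fun t => Φ (0, t)) t))
  obtain ⟨ε, hε, hd⟩ := Ψ.exists_curve_disjoint L.isCompact_shadow h0
  have e : P.toLink.isotopyClass = (Ψ.knot hv hε).toLink.isotopyClass :=
    Quot.sound (Ψ.isotopic_knot hv h7 hε)
  rw [e]
  refine Quot.sound (isotopic_superpose_comm (disjoint_left.mpr ?_))
  rintro _ ⟨_, ⟨t, rfl⟩, rfl⟩
  exact hd t

/-- The skein of a curve parallel to a boundary component is central. -/
theorem FramedKnot.IsParallelTo.skein_commute [T2Space S] (A : ℂ) (o : SurfaceOrientation S)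
    {C : Set S} (hC : IsBoundaryComponent S C) {P : FramedKnot S} (hP : P.IsParallelTo C)
    (a : SkeinAlgebra A o) : Commute (skein A o P.toLink) a := by
  obtain ⟨b, rfl⟩ := RingQuot.mkAlgHom_surjective ℂ (SkeinRelation A o) a
  refine Commute.map ?_ _
  -- Commutation is proved on lifts to the monoid algebra, where it reduces to single isotopy
  -- classes.
  induction b using MonoidAlgebra.induction_on with
  | of c => exact Commute.map (hP.isotopyClass_comm hC c) (MonoidAlgebra.of ℂ (IsotopyClass S))
  | add f g hf hg => exact hf.add_right hg
  | smul z f hf => exact hf.smul_right z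

end Isotopy

/-! ### Scalar action and the Chebyshev equation -/

/-- Schur's lemma: central elements act by scalars in an irreducible representation. -/
theorem IsIrreducibleRep.exists_eq_smul_id {𝒜 V : Type*} [Ring 𝒜] [Algebra ℂ 𝒜] [AddCommGroup V]
    [Module ℂ V] [FiniteDimensional ℂ V] {ρ : 𝒜 →ₐ[ℂ] Module.End ℂ V} (hρ : IsIrreducibleRep ρ)
    {z : 𝒜} (hz : ∀ a, Commute z a) : ∃ p : ℂ, ρ z = p • LinearMap.id := by
  obtain ⟨_, hirr⟩ := hρ
  obtain ⟨p, hp⟩ := Module.End.exists_eigenvalue (ρ z)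
  refine ⟨p, ?_⟩
  -- An eigenspace of a central element is invariant under the whole algebra; being nonzero, it is
  -- all of `V`.
  have htop := (hirr (Module.End.eigenspace (ρ z) p) fun a v hv => by
    rw [Module.End.mem_eigenspace_iff] at hv ⊢
    have h := LinearMap.congr_fun ((hz a).map ρ).eq v
    rw [Module.End.mul_apply, Module.End.mul_apply, hv, map_smul] at h
    exact h).resolve_left hp
  ext v
  have hv : v ∈ Module.End.eigenspace (ρ z) p := htop ▸ Submodule.mem_top
  simpa using Module.End.mem_eigenspace_iff.mp hv

/-- Used both for the uniqueness of the puncture invariant and to read off an equality of numbers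
from an equality of scalar operators. -/
theorem smul_id_injective (V : Type*) [AddCommGroup V] [Module ℂ V] [Nontrivial V] :
    Function.Injective fun z : ℂ => z • (LinearMap.id : Module.End ℂ V) := by
  intro z w h
  obtain ⟨v, hv⟩ := exists_ne (0 : V)
  exact smul_left_injective ℂ hv (LinearMap.congr_fun h v)

theorem aeval_smul_id (V : Type*) [AddCommGroup V] [Module ℂ V] (f : Polynomial ℂ) (p : ℂ) :
    Polynomial.aeval (p • (LinearMap.id : Module.End ℂ V)) f = f.eval p • LinearMap.id := by
  have h : ∀ z : ℂ, z • (LinearMap.id : Module.End ℂ V) = algebraMap ℂ (Module.End ℂ V) z :=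
    fun z => (Algebra.algebraMap_eq_smul_one z).symm
  rw [h, h, Polynomial.aeval_algebraMap_apply, Polynomial.coe_aeval_eq_eval]

/-- On a simple closed curve acting by a scalar `p`, the homomorphism `κ_ρ` takes the value
`T_N(p)`. -/
theorem IsChebyshevHom.eval_eq {S : Type*} [TopologicalSpace S]
    [ChartedSpace (EuclideanHalfSpace 2) S] [IsManifold (𝓡∂ 2) ∞ S] {o : SurfaceOrientation S}
    {A : ℂ} {V : Type*} [AddCommGroup V] [Module ℂ V] [Nontrivial V] {N : ℕ}
    {ρ : SkeinAlgebra A o →ₐ[ℂ] Module.End ℂ V} {κ : SkeinAlgebra 1 o →ₐ[ℂ] ℂ}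
    (hκ : IsChebyshevHom N ρ κ) {P : FramedKnot S} (hP : P.IsSimpleVertical) {p : ℂ}
    (hp : ρ (skein A o P.toLink) = p • LinearMap.id) :
    (chebyshev N).eval p = κ (skein 1 o P.toLink) := by
  have h := hκ P hP
  -- An algebra homomorphism commutes with polynomials, so `ρ(T_N([P]))` is `T_N` of a scalar
  -- operator.
  rw [← Polynomial.aeval_algHom_apply, hp, aeval_smul_id] at h
  exact smul_id_injective V h

/-- The solutions are roots of `T_N - c`, which is not the zero polynomial: for odd `N`, `T_N(2) =
2` and `T_N(-2) = -2`, so `T_N` is not constant. -/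
theorem finite_setOf_chebyshev_eval_eq {N : ℕ} (hN : Odd N) (c : ℂ) :
    {z : ℂ | (chebyshev N).eval z = c}.Finite := by
  have hne : chebyshev N - Polynomial.C c ≠ 0 := by
    intro h
    have h1 := congrArg (Polynomial.eval 2) h
    have h2 := congrArg (Polynomial.eval (-2)) h
    simp only [chebyshev, Polynomial.eval_sub, Polynomial.eval_C, Polynomial.eval_zero,
      Polynomial.Chebyshev.C_eval_two, Polynomial.Chebyshev.C_eval_neg_two,
      Int.negOnePow_odd _ ((Int.odd_coe_nat N).mpr hN)] at h1 h2
    norm_num at h1 h2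
    have h3 : (4 : ℂ) = 0 := by linear_combination h1 - h2
    norm_num at h3
  refine ((chebyshev N - Polynomial.C c).roots.toFinset.finite_toSet).subset fun z hz => ?_
  simpa [hne, sub_eq_zero] using hz

end KauffmanSkein

theorem lemma4p3 {S : Type*} [TopologicalSpace S] [T2Space S] [CompactSpace S]
    [PathConnectedSpace S] [ChartedSpace (EuclideanHalfSpace 2) S] [IsManifold (𝓡∂ 2) ∞ S]
    (o : KauffmanSkein.SurfaceOrientation S) (x₀ : S)
    {N : ℕ} (hN : Odd N) {A : ℂ} (hA : IsPrimitiveRoot A N)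
    {V : Type*} [AddCommGroup V] [Module ℂ V] [FiniteDimensional ℂ V]
    (ρ : KauffmanSkein.SkeinAlgebra A o →ₐ[ℂ] Module.End ℂ V)
    (hρ : KauffmanSkein.IsIrreducibleRep ρ)
    (r : KauffmanSkein.SpinnedHom x₀) (hr : KauffmanSkein.IsClassicalShadow N ρ r)
    (C : Set S) (hC : KauffmanSkein.IsBoundaryComponent S C)
    (P : KauffmanSkein.FramedKnot S) (hP : P.IsParallelTo C) :
    ∃ p : ℂ,
      (∀ z : ℂ, KauffmanSkein.IsPunctureInvariant ρ P z ↔ z = p) ∧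
      (∀ κ : KauffmanSkein.SkeinAlgebra 1 o →ₐ[ℂ] ℂ, KauffmanSkein.IsChebyshevHom N ρ κ →
        (KauffmanSkein.chebyshev N).eval p = κ (KauffmanSkein.skein 1 o P.toLink) ∧
        κ (KauffmanSkein.skein 1 o P.toLink) = -r.trace P) ∧
      p ∈ {z : ℂ | (KauffmanSkein.chebyshev N).eval z = -r.trace P} ∧
      {z : ℂ | (KauffmanSkein.chebyshev N).eval z = -r.trace P}.Finite := by
  have := hρ.1
  obtain ⟨p, hp⟩ := hρ.exists_eq_smul_id (hP.skein_commute A o hC)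
  obtain ⟨κ, hκ, -, htr⟩ := hr
  have hmain : (KauffmanSkein.chebyshev N).eval p = -r.trace P := (hκ.eval_eq hP.1 hp).trans (htr P)
  -- Any other `κ'` with the Chebyshev property also takes the value `T_N(p)` on `P`, so it agrees
  -- there with the `κ` that provides the shadow.
  refine ⟨p, fun z => ⟨fun hz => KauffmanSkein.smul_id_injective V (hz.symm.trans hp), ?_⟩,
    fun κ' hκ' => ⟨hκ'.eval_eq hP.1 hp, (hκ'.eval_eq hP.1 hp).symm.trans hmain⟩, hmain,
    KauffmanSkein.finite_setOf_chebyshev_eval_eq hN _⟩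
  rintro rfl
  exact hp
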